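/- **Setting.** Let $(\Omega,\mathcal F,\mathbb P)$ be a probability space and let $U=\bigcup_{\tau\in\mathcal S}\tau\subset\mathbb R^d$ be the union of a set $\mathcal S$ of $N$ simplices of dimension $k$ of a finite simplicial complex of dimension at most $k$; integrals over $U$ are with respect to $k$-dimensional surface measure (Lebesgue measure if $k=d$). Let $\chi^j_\tau=c^j_\tau[0,\dots,0,1_\tau,0,\dots,0]^{\rm T}$ (indicator of $\tau$ in the $j$-th entry), $\tau\in\mathcal S$, $1\le j\le q$, with real coefficients $c^j_\tau$ such that these functions are orthonormal in $L^2(U;\mathbb R^q)$. Let $v\in L^2_{\mathbb P}(\Omega;L^2(U;\mathbb R^q))$ be a random vector field with mean zero, and let $(\lambda_i,\phi_i)_{i\ge1}$ be its Karhunen–Loève eigenpairs: the $\phi_i$ are orthonormal eigenfunctions, with eigenvalues $\lambda_1\ge\lambda_2\ge\dots\ge0$, of the covariance operator $(C_vf)(x)=\int_U{\rm Cov}(v(x),v(y))f(y)\,dy$, and $C_v$ vanishes on the orthogonal complement of all the $\phi_i$. Let $M<N$ and suppose that $\phi_1,\dots,\phi_M$ lie in the span of the $\chi^j_\tau$, and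 that $\sum_{i\ge M+1}\lambda_i>0$. **Multilevel basis.** Build a binary tree of cells by splitting the set of barycenters of the simplices recursively by hyperplanes $\{x\cdot n\le t\}$, $\{x\cdot n>t\}$ chosen by some splitting rule (for example the kd-tree rule: $n$ is a coordinate direction of maximal sample variance and $t$ a median of the projections), until each cell at the ends of the tree contains fewer than $n_0$ barycenters. Going from the leaves to the root, attach to the $k$-th cell $B^l_k$ of level $l$ an orthonormal family $e_1,\dots,e_s$: at a leaf, the functions $\chi^j_\tau$ whose barycenters lie in the cell; at any other cell, the functions handed on by its two children. Take a singular value decomposition $A=PDV^{\rm T}$ of the matrix $A=\big((\phi_i,e_j)\big)_{i\le M,\,j\le s}$, with the singular values in nonincreasing order, let $a$ be the rank of $A$, and put $f_j=\sum_iV_{ij}e_i$. The functions $f_1,\dots,f_a$ are handed on to the parent cell, and $\psi^{l,k}_p:=f_p$, $p=a+1,\dots,s$, are the multilevel basis functions of the cell. **Theorem (Detection: Hypothesis Test).** Let $u$ be an observed random field and let $d^{l,k}_p(\omega)=\int_Uu(x,\omega)^{\rm T}\psi^{l,k}_p(x)\,dx$ be its multilevel projection coefficients. If the null hypothesis $H_0:u=v$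 (almost everywhere on $U\times\Omega$) is true, then for every significance level $0<\alpha\le1$, every level $l$, every cell $B^l_k$ and every index $p$, $$\mathbb P\Big(|d^{l,k}_p|\ \ge\ \alpha^{-1/2}\Big(\sum_{i\ge M+1}\lambda_i\Big)^{1/2}\Big)\le\alpha .$$ No assumption on the distribution of $v$ beyond the above is made. -/

import Mathlib

open MeasureTheory ProbabilityTheory
open scoped BigOperators MeasureTheory ProbabilityTheory

noncomputable section

/-! ### The domain: a union of `k`-simplices of a simplicial complex in `ℝ^d` -/

/-- `𝒮` is a finite set of `k`-simplices of the `k`-dimensional simplicial complex `T`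
(a simplex is given by its finite set of vertices, so a `k`-simplex has `k + 1` of them). -/
structure IsSimplicialMesh {d : ℕ}
    (T : Geometry.SimplicialComplex ℝ (EuclideanSpace ℝ (Fin d))) (k : ℕ)
    (𝒮 : Finset (Finset (EuclideanSpace ℝ (Fin d)))) : Prop where
  finite : T.faces.Finite
  dim_le : ∀ τ ∈ T.faces, τ.card ≤ k + 1
  subset : ∀ τ ∈ 𝒮, τ ∈ T.faces
  dim_eq : ∀ τ ∈ 𝒮, τ.card = k + 1

/-- The domain `U`, the union of the simplices of `𝒮`. -/
def meshDomain {d : ℕ} (𝒮 : Finset (Finset (EuclideanSpace ℝ (Fin d)))) :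
    Set (EuclideanSpace ℝ (Fin d)) :=
  ⋃ τ ∈ 𝒮, convexHull ℝ (τ : Set (EuclideanSpace ℝ (Fin d)))

/-- The measure `dx` on `U`: the `k`-dimensional surface measure, that is the Hausdorff measure
`μHE[k]` (normalized so that it is Lebesgue measure in `ℝ^k`), restricted to `U`. -/
def meshMeasure {d : ℕ} (k : ℕ) (𝒮 : Finset (Finset (EuclideanSpace ℝ (Fin d)))) :
    Measure (EuclideanSpace ℝ (Fin d)) :=
  (μHE[k] : Measure (EuclideanSpace ℝ (Fin d))).restrict (meshDomain 𝒮)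

/-- The barycenter of a simplex. -/
def barycenter {d : ℕ} {𝒮 : Finset (Finset (EuclideanSpace ℝ (Fin d)))} (τ : 𝒮) :
    EuclideanSpace ℝ (Fin d) :=
  τ.1.centroid ℝ id

/-- The space `L²(U; ℝ^q)`, with its usual inner product. -/
abbrev L2Space {X : Type*} [MeasurableSpace X] (μ : Measure X) (q : ℕ) : Type _ :=
  Lp (EuclideanSpace ℝ (Fin q)) 2 μ

/-- The functions `χ τ j = c · [0, …, 0, 1_τ, 0, …, 0]` (indicator of `τ` in the `j`-th entry),
for coefficients `c` (depending on `τ` and `j`) that make the whole family orthonormal. -/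
structure IsIndicatorBasis {d k q : ℕ} (𝒮 : Finset (Finset (EuclideanSpace ℝ (Fin d))))
    (χ : 𝒮 → Fin q → L2Space (meshMeasure k 𝒮) q) : Prop where
  eq_indicator : ∀ (τ : 𝒮) (j : Fin q), ∃ c : ℝ,
    χ τ j =ᵐ[meshMeasure k 𝒮]
      (convexHull ℝ (τ.1 : Set (EuclideanSpace ℝ (Fin d)))).indicator
        (fun _ => EuclideanSpace.single j c)
  orthonormal : Orthonormal ℝ (fun p : 𝒮 × Fin q => χ p.1 p.2)

/-! ### Random vector fields and their Karhunen-Loève eigenpairs -/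

/-- The matrix-valued covariance function
`Cov(v(x), v(y)) = [Cov(v_i(x, ·), v_j(y, ·))]_{i,j}`. -/
def covFn {X Ω : Type*} [MeasurableSpace Ω] (P : Measure Ω) {q : ℕ}
    (v : X → Ω → EuclideanSpace ℝ (Fin q)) (x y : X) : Matrix (Fin q) (Fin q) ℝ :=
  Matrix.of fun i j => cov[fun ω => v x ω i, fun ω => v y ω j; P]

/-- The covariance operator `(C_v u)(x) = ∫_U Cov(v(x), v(y)) u(y) dy`. -/
def covOp {X Ω : Type*} [MeasurableSpace X] [MeasurableSpace Ω] (μ : Measure X) (P : Measure Ω)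
    {q : ℕ} (v : X → Ω → EuclideanSpace ℝ (Fin q)) (u : X → EuclideanSpace ℝ (Fin q)) (x : X) :
    EuclideanSpace ℝ (Fin q) :=
  ∫ y, WithLp.toLp 2 ((covFn P v x y).mulVec (u y)) ∂μ

/-- `v` is a square integrable random vector field, `v ∈ L²_P(Ω; L²(U; ℝ^q))`, given as a function
of `(x, ω)`. -/
def IsL2Field {X Ω : Type*} [MeasurableSpace X] [MeasurableSpace Ω] (μ : Measure X)
    (P : Measure Ω) {q : ℕ} (v : X → Ω → EuclideanSpace ℝ (Fin q)) : Prop :=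
  MemLp (fun z : X × Ω => v z.1 z.2) 2 (μ.prod P)

/-- `(lam i, φ i)`, `i = 0, 1, 2, …`, is the system of Karhunen-Loève eigenpairs of the field `v`:
the `φ i` are orthonormal eigenfunctions of the covariance operator with eigenvalues
`lam 0 ≥ lam 1 ≥ … ≥ 0`, and the operator vanishes on the functions orthogonal to all of them, so
that nonzero eigenvalues are listed completely and with their multiplicities. -/
structure IsKLSystem {X Ω : Type*} [MeasurableSpace X] [MeasurableSpace Ω] (μ : Measure X)
    (P : Measure Ω) {q : ℕ} (v : X → Ω → EuclideanSpace ℝ (Fin q)) (lam : ℕ → ℝ)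
    (φ : ℕ → L2Space μ q) : Prop where
  orthonormal : Orthonormal ℝ φ
  antitone : Antitone lam
  nonneg : ∀ i, 0 ≤ lam i
  eigen : ∀ i, covOp μ P v (φ i) =ᵐ[μ] fun x => lam i • φ i x
  exhaustive : ∀ u : L2Space μ q, (∀ i, inner ℝ (φ i) u = 0) → covOp μ P v u =ᵐ[μ] 0

/-! ### The tree of cells and the multilevel basis -/

/-- `A = P D Vᵀ` is a singular value decomposition: `P`, `V` are orthogonal and `D` is a rectangular
diagonal matrix with nonnegative, nonincreasing diagonal entries. -/
structure IsSVD {m s : ℕ} (A : Matrix (Fin m) (Fin s) ℝ) (P : Matrix (Fin m) (Fin m) ℝ)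
    (D : Matrix (Fin m) (Fin s) ℝ) (V : Matrix (Fin s) (Fin s) ℝ) : Prop where
  left_orthogonal : P ∈ Matrix.orthogonalGroup (Fin m) ℝ
  right_orthogonal : V ∈ Matrix.orthogonalGroup (Fin s) ℝ
  diagonal : ∀ (i : Fin m) (j : Fin s), (i : ℕ) ≠ (j : ℕ) → D i j = 0
  nonneg : ∀ i j, 0 ≤ D i j
  nonincreasing : ∀ (i i' : Fin m) (j j' : Fin s),
    (i : ℕ) = (j : ℕ) → (i' : ℕ) = (j' : ℕ) → i ≤ i' → D i' j' ≤ D i j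
  eq_mul : A = P * D * V.transpose

/-- The matrix of inner products `(φ_i, e_j)`. -/
def innerMatrix {H : Type*} [NormedAddCommGroup H] [InnerProductSpace ℝ H] {m s : ℕ}
    (φ : Fin m → H) (e : Fin s → H) : Matrix (Fin m) (Fin s) ℝ :=
  Matrix.of fun i j => inner ℝ (φ i) (e j)

/-- The orthogonalization step in a cell. From the functions `e_1, …, e_s` one forms
`f_j = ∑_i V_{ij} e_i`, where `V` comes from a singular value decomposition of the matrix of inner
products `(φ_i, e_j)`. With `a` the rank of that matrix, the first `a` of the `f_j` are the functions
`C` handed on to the parent cell, and the others are the basis functions `D` of the cell. -/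
def IsSVDStep {H : Type*} [NormedAddCommGroup H] [InnerProductSpace ℝ H] {m : ℕ}
    (φ : Fin m → H) (e C D : List H) : Prop :=
  ∃ (P : Matrix (Fin m) (Fin m) ℝ) (S : Matrix (Fin m) (Fin e.length) ℝ)
    (V : Matrix (Fin e.length) (Fin e.length) ℝ),
    IsSVD (innerMatrix φ e.get) P S V ∧
    C = (List.ofFn fun j => ∑ i, V i j • e.get i).take (innerMatrix φ e.get).rank ∧
    D = (List.ofFn fun j => ∑ i, V i j • e.get i).drop (innerMatrix φ e.get).rank

/-- What is attached to a cell `B^l_k`: the simplices whose barycenters lie in it, the functions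
`C^l_k` and the multilevel basis functions `D^l_k = {ψ^{l,k}_p}`. -/
structure CellData (ι H : Type*) where
  members : Finset ι
  C : List H
  D : List H

/-- Binary trees of cells. -/
inductive CellTree (ι H : Type*) where
  | leaf (B : CellData ι H) : CellTree ι H
  | node (B : CellData ι H) (left right : CellTree ι H) : CellTree ι H

/-- The root cell of a tree. -/
def CellTree.root {ι H : Type*} : CellTree ι H → CellData ι H
  | .leaf B => B
  | .node B _ _ => B

/-- The cells at level `l` (the root is at level `0`). -/
def CellTree.level {ι H : Type*} : CellTree ι H → ℕ → List (CellData ι H)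
  | t, 0 => [t.root]
  | .leaf _, _ + 1 => []
  | .node _ L R, l + 1 => L.level l ++ R.level l

/-- A splitting rule: it tells by which directions `n` and thresholds `t` a cell containing the
points `x i`, `i ∈ S`, may be split into `{x · n ≤ t}` and `{x · n > t}`. -/
abbrev SplitRule (ι : Type*) (d : ℕ) : Type _ :=
  Finset ι → EuclideanSpace ℝ (Fin d) → ℝ → Prop

open scoped Classical in
/-- The kd-tree rule: the direction is a coordinate direction along which the sample variance of the
projected points is maximal, and the threshold is a median of the projections. -/
def kdRule {ι : Type*} {d : ℕ} (x : ι → EuclideanSpace ℝ (Fin d)) : SplitRule ι d :=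
  fun S n t =>
    let variance : Fin d → ℝ := fun j =>
      (∑ i ∈ S, (x i j - (∑ i' ∈ S, x i' j) / S.card) ^ 2) / (S.card - 1 : ℝ)
    ∃ j : Fin d, n = EuclideanSpace.single j 1 ∧ (∀ j', variance j' ≤ variance j) ∧
      S.card ≤ 2 * (S.filter fun i => x i j ≤ t).card ∧
      S.card ≤ 2 * (S.filter fun i => t ≤ x i j).card

open scoped Classical in
/-- `t` is a tree produced from the points `x i`, `i ∈ S`, with the multilevel basis built on it:
* a cell with fewer than `n₀` points is a leaf; there the orthogonalization step is applied to the
  functions `χ i j` (in any order) with `i` in the cell;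
* any other cell is split in two according to the rule, and the orthogonalization step is applied to
  the functions `C` of its two children. -/
def IsMultilevelTree {ι H : Type*} [NormedAddCommGroup H] [InnerProductSpace ℝ H] {d m q : ℕ}
    (x : ι → EuclideanSpace ℝ (Fin d)) (rule : SplitRule ι d) (n₀ : ℕ)
    (φ : Fin m → H) (χ : ι → Fin q → H) : Finset ι → CellTree ι H → Prop
  | S, .leaf B =>
      B.members = S ∧ S.card < n₀ ∧
      ∃ o : List (ι × Fin q), o.Nodup ∧ (∀ p, p ∈ o ↔ p.1 ∈ S) ∧
        IsSVDStep φ (o.map fun p => χ p.1 p.2) B.C B.D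
  | S, .node B L R =>
      B.members = S ∧ n₀ ≤ S.card ∧
      (∃ (n : EuclideanSpace ℝ (Fin d)) (t : ℝ), rule S n t ∧
        IsMultilevelTree x rule n₀ φ χ (S.filter fun i => inner ℝ (x i) n ≤ t) L ∧
        IsMultilevelTree x rule n₀ φ χ (S.filter fun i => ¬ inner ℝ (x i) n ≤ t) R) ∧
      IsSVDStep φ (L.root.C ++ R.root.C) B.C B.D

/-- The projection coefficient `d(ω) = ∫_U u(x, ω)ᵀ ψ(x) dx`. -/
def projCoeff {X Ω : Type*} [MeasurableSpace X] (μ : Measure X) {q : ℕ}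
    (u : X → Ω → EuclideanSpace ℝ (Fin q)) (ψ : L2Space μ q) (ω : Ω) : ℝ :=
  ∫ x, inner ℝ (u x ω) (ψ x) ∂μ

end

/-!
The basis functions of a cell come from the columns of `V` beyond the rank of `A`, on which `A`
vanishes, so they are orthogonal to `φ_1, …, φ_M`; they are unit vectors because disjoint cells
carry orthogonal functions and `V` is orthogonal. Let `T f = ∫_U v(x, ·)ᵀ f(x) dx`. For a centred
field `(f, C_v g) = E[T f · T g]`, hence `E[(T ψ)²] = ∑_i λ_i (φ_i, ψ)²` by expanding `T ψ` along
the `φ_i`: as `T` kills their orthogonal complement, neither the compactness of `C_v` nor the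
spectral theorem is needed. For a basis function `ψ` only the terms with `i > M` survive, and
Chebyshev's inequality concludes.
-/

/-! ### The tail columns of a singular value decomposition -/

section SVD

variable {m s : ℕ} {A : Matrix (Fin m) (Fin s) ℝ} {P : Matrix (Fin m) (Fin m) ℝ}
  {D : Matrix (Fin m) (Fin s) ℝ} {V : Matrix (Fin s) (Fin s) ℝ}

theorem IsSVD.rank_eq (h : IsSVD A P D V) : A.rank = D.rank := by
  have hP : IsUnit P.det := Matrix.isUnit_det_of_left_inverse <|
    (Matrix.mem_orthogonalGroup_iff' (Fin m) ℝ).1 h.left_orthogonal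
  have hV : IsUnit V.transpose.det := Matrix.isUnit_det_of_right_inverse <|
    (Matrix.mem_orthogonalGroup_iff' (Fin s) ℝ).1 h.right_orthogonal
  rw [h.eq_mul, Matrix.rank_mul_eq_left_of_isUnit_det _ _ hV,
    Matrix.rank_mul_eq_right_of_isUnit_det _ _ hP]

theorem IsSVD.lt_rank_of_apply_ne_zero (h : IsSVD A P D V) {i : Fin m} {j : Fin s}
    (hne : D i j ≠ 0) : (j : ℕ) < A.rank := by
  have hij : (i : ℕ) = j := not_imp_comm.1 (h.diagonal i j) hne
  have hpos : 0 < D i j := (h.nonneg i j).lt_of_ne' hne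
  -- As the singular values decrease, the leading block of size `j + 1` is invertible.
  let row : Fin (j + 1) → Fin m := fun a => ⟨a, by omega⟩
  let col : Fin (j + 1) → Fin s := fun a => ⟨a, by omega⟩
  have hblock : D.submatrix row col = Matrix.diagonal fun a => D (row a) (col a) := by
    ext a b
    rcases eq_or_ne a b with rfl | hab
    · simp
    · rw [Matrix.diagonal_apply_ne _ hab]
      exact h.diagonal _ _ fun hval => hab (Fin.ext hval)
  have hdet : (D.submatrix row col).det ≠ 0 := by
    rw [hblock, Matrix.det_diagonal, Finset.prod_ne_zero_iff]
    intro a _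
    have hle : row a ≤ i := by
      rw [Fin.le_def, hij]
      exact Nat.lt_succ_iff.1 a.2
    exact (hpos.trans_le (h.nonincreasing _ _ _ _ rfl hij hle)).ne'
  calc (j : ℕ) < (D.submatrix row col).rank := by
        rw [Matrix.rank_of_det_ne_zero hdet, Fintype.card_fin]
        exact Nat.lt_succ_self j
    _ ≤ D.rank := Matrix.rank_submatrix_le D row col
    _ = A.rank := h.rank_eq.symm

theorem IsSVD.mul_right_apply_eq_zero (h : IsSVD A P D V) (i : Fin m) {j : Fin s}
    (hj : A.rank ≤ j) : (A * V) i j = 0 := by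
  have hV : V.transpose * V = 1 :=
    (Matrix.mem_orthogonalGroup_iff' (Fin s) ℝ).1 h.right_orthogonal
  have hAV : A * V = P * D := by rw [h.eq_mul, Matrix.mul_assoc, hV, Matrix.mul_one]
  rw [hAV, Matrix.mul_apply]
  refine Finset.sum_eq_zero fun a _ => ?_
  rw [not_imp_comm.1 h.lt_rank_of_apply_ne_zero hj.not_gt, mul_zero]

end SVD

/-! ### The multilevel basis -/

section MultilevelBasis

variable {H : Type*} [NormedAddCommGroup H] [InnerProductSpace ℝ H]

/-- Orthonormal lists, the form in which the bases attached to the cells are handed on. Stating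
orthogonality by `List.Pairwise` makes sublists and concatenations of such lists easy to handle. -/
def IsOrthonormalList (e : List H) : Prop :=
  e.Pairwise (fun x y => inner ℝ x y = 0) ∧ ∀ x ∈ e, ‖x‖ = 1

namespace IsOrthonormalList

variable {e e' : List H}

theorem orthonormal_get (h : IsOrthonormalList e) : Orthonormal ℝ e.get := by
  refine ⟨fun i => h.2 _ (e.get_mem i), fun i j hij => ?_⟩
  rcases hij.lt_or_gt with hlt | hgt
  · exact List.pairwise_iff_get.1 h.1 i j hlt
  · exact inner_eq_zero_symm.1 (List.pairwise_iff_get.1 h.1 j i hgt)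

theorem of_orthonormal_ofFn {n : ℕ} {f : Fin n → H} (hf : Orthonormal ℝ f) :
    IsOrthonormalList (List.ofFn f) :=
  ⟨List.pairwise_ofFn.2 fun _ _ hij => hf.2 hij.ne, List.forall_mem_ofFn_iff.2 hf.1⟩

theorem of_orthonormal_map {ι : Type*} {f : ι → H} (hf : Orthonormal ℝ f) {o : List ι}
    (ho : o.Nodup) : IsOrthonormalList (o.map f) :=
  ⟨List.pairwise_map.2 (ho.imp fun hne => hf.2 hne), List.forall_mem_map.2 fun i _ => hf.1 i⟩

theorem sublist (h : IsOrthonormalList e) (hs : e'.Sublist e) : IsOrthonormalList e' :=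
  ⟨h.1.sublist hs, fun x hx => h.2 x (hs.subset hx)⟩

theorem append (h : IsOrthonormalList e) (h' : IsOrthonormalList e')
    (horth : ∀ x ∈ e, ∀ y ∈ e', inner ℝ x y = 0) : IsOrthonormalList (e ++ e') :=
  ⟨List.pairwise_append.2 ⟨h.1, h'.1, horth⟩, List.forall_mem_append.2 ⟨h.2, h'.2⟩⟩

end IsOrthonormalList

theorem orthonormal_sum_smul_of_mem_orthogonalGroup {n : Type*} [Fintype n] [DecidableEq n]
    {e : n → H} (he : Orthonormal ℝ e) {V : Matrix n n ℝ} (hV : V ∈ Matrix.orthogonalGroup n ℝ) :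
    Orthonormal ℝ fun j => ∑ i, V i j • e i := by
  rw [orthonormal_iff_ite]
  intro j l
  have hjl : (V.transpose * V) j l = if j = l then 1 else 0 := by
    rw [(Matrix.mem_orthogonalGroup_iff' n ℝ).1 hV, Matrix.one_apply]
  rw [he.inner_sum, ← hjl, Matrix.mul_apply]
  simp only [conj_trivial, Matrix.transpose_apply]

namespace IsSVDStep

variable {m : ℕ} {φ : Fin m → H} {e C D : List H}

theorem isOrthonormalList (h : IsSVDStep φ e C D) (he : IsOrthonormalList e) :
    IsOrthonormalList C ∧ IsOrthonormalList D := by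
  obtain ⟨P, S, V, hSVD, rfl, rfl⟩ := h
  have hf := IsOrthonormalList.of_orthonormal_ofFn <|
    orthonormal_sum_smul_of_mem_orthogonalGroup he.orthonormal_get hSVD.right_orthogonal
  exact ⟨hf.sublist (List.take_sublist _ _), hf.sublist (List.drop_sublist _ _)⟩

theorem mem_of_forall_mem (h : IsSVDStep φ e C D) {K : Submodule ℝ H} (he : ∀ x ∈ e, x ∈ K) :
    ∀ x ∈ C, x ∈ K := by
  obtain ⟨P, S, V, -, rfl, -⟩ := h
  intro x hx
  obtain ⟨j, rfl⟩ := (List.mem_ofFn' _ _).1 (List.mem_of_mem_take hx)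
  exact K.sum_mem fun i _ => K.smul_mem _ (he _ (e.get_mem i))

theorem inner_eq_zero (h : IsSVDStep φ e C D) (i : Fin m) {x : H} (hx : x ∈ D) :
    inner ℝ (φ i) x = 0 := by
  obtain ⟨P, S, V, hSVD, -, rfl⟩ := h
  obtain ⟨p, hp, rfl⟩ := List.mem_iff_getElem.1 hx
  rw [List.length_drop, List.length_ofFn] at hp
  let j : Fin e.length := ⟨(innerMatrix φ e.get).rank + p, by omega⟩
  rw [List.getElem_drop, List.getElem_ofFn]
  calc inner ℝ (φ i) (∑ a, V a j • e.get a)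
      = (innerMatrix φ e.get * V) i j := by
        simp only [inner_sum, inner_smul_right, Matrix.mul_apply, innerMatrix, Matrix.of_apply,
          mul_comm]
    _ = 0 := hSVD.mul_right_apply_eq_zero i (Nat.le_add_right _ p)

end IsSVDStep

/-- The span of the functions `χ i j` with `i` in the cell `S`: the space in which the functions
attached to that cell live. Disjoint cells have orthogonal spans. -/
def cellSpan {ι κ : Type*} (χ : ι → κ → H) (S : Finset ι) : Submodule ℝ H :=
  Submodule.span ℝ {y | ∃ i ∈ S, ∃ j, χ i j = y}

section CellSpan

variable {ι κ : Type*} {χ : ι → κ → H} {S S' : Finset ι}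

theorem apply_mem_cellSpan {i : ι} (hi : i ∈ S) (j : κ) : χ i j ∈ cellSpan χ S :=
  Submodule.subset_span ⟨i, hi, j, rfl⟩

theorem cellSpan_mono (h : S ⊆ S') : cellSpan χ S ≤ cellSpan χ S' :=
  Submodule.span_mono fun _ ⟨i, hi, hy⟩ => ⟨i, h hi, hy⟩

theorem isOrtho_cellSpan (hχ : Orthonormal ℝ fun p : ι × κ => χ p.1 p.2) (h : Disjoint S S') :
    cellSpan χ S ⟂ cellSpan χ S' := by
  refine Submodule.isOrtho_span.2 ?_
  rintro _ ⟨i, hi, j, rfl⟩ _ ⟨i', hi', j', rfl⟩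
  refine hχ.2 (i := (i, j)) (j := (i', j')) fun heq => ?_
  obtain rfl : i = i' := congrArg Prod.fst heq
  exact Finset.disjoint_left.1 h hi hi'

end CellSpan

namespace IsMultilevelTree

variable {ι : Type*} {d m q n₀ : ℕ} {x : ι → EuclideanSpace ℝ (Fin d)} {rule : SplitRule ι d}
  {φ : Fin m → H} {χ : ι → Fin q → H} {t : CellTree ι H} {S : Finset ι}

theorem exists_isSVDStep_root (hχ : Orthonormal ℝ fun p : ι × Fin q => χ p.1 p.2)
    (ht : IsMultilevelTree x rule n₀ φ χ S t) :
    ∃ e : List H, IsOrthonormalList e ∧ (∀ y ∈ e, y ∈ cellSpan χ S) ∧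
      IsSVDStep φ e t.root.C t.root.D := by
  induction t generalizing S with
  | leaf B =>
    obtain ⟨-, -, o, ho, hmem, hstep⟩ := ht
    exact ⟨_, .of_orthonormal_map hχ ho,
      List.forall_mem_map.2 fun p hp => apply_mem_cellSpan ((hmem p).1 hp) p.2, hstep⟩
  | node B L R ihL ihR =>
    obtain ⟨-, -, ⟨n, c, -, hL, hR⟩, hstep⟩ := ht
    obtain ⟨eL, heL, hspanL, hstepL⟩ := ihL hL
    obtain ⟨eR, heR, hspanR, hstepR⟩ := ihR hR
    have hCL := hstepL.mem_of_forall_mem hspanL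
    have hCR := hstepR.mem_of_forall_mem hspanR
    refine ⟨_, (hstepL.isOrthonormalList heL).1.append (hstepR.isOrthonormalList heR).1
      fun y hy z hz => ?_, ?_, hstep⟩
    · refine (isOrtho_cellSpan hχ ?_).inner_eq (hCL y hy) (hCR z hz)
      exact Finset.disjoint_left.2 fun i hi hi' =>
        (Finset.mem_filter.1 hi').2 (Finset.mem_filter.1 hi).2
    · exact List.forall_mem_append.2
        ⟨fun y hy => cellSpan_mono (Finset.filter_subset _ _) (hCL y hy),
          fun y hy => cellSpan_mono (Finset.filter_subset _ _) (hCR y hy)⟩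

theorem exists_subtree_of_mem_level (ht : IsMultilevelTree x rule n₀ φ χ S t) {l : ℕ}
    {B : CellData ι H} (hB : B ∈ t.level l) :
    ∃ (S' : Finset ι) (t' : CellTree ι H),
      IsMultilevelTree x rule n₀ φ χ S' t' ∧ t'.root = B := by
  induction t generalizing S l with
  | leaf B₀ =>
    cases l with
    | zero => exact ⟨S, _, ht, (List.mem_singleton.1 hB).symm⟩
    | succ l => exact absurd hB List.not_mem_nil
  | node B₀ L R ihL ihR =>
    cases l with
    | zero => exact ⟨S, _, ht, (List.mem_singleton.1 hB).symm⟩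
    | succ l =>
      obtain ⟨-, -, ⟨n, c, -, hL, hR⟩, -⟩ := ht
      exact (List.mem_append.1 hB).elim (ihL hL) (ihR hR)

theorem exists_isSVDStep (hχ : Orthonormal ℝ fun p : ι × Fin q => χ p.1 p.2)
    (ht : IsMultilevelTree x rule n₀ φ χ S t) {l : ℕ} {B : CellData ι H} (hB : B ∈ t.level l) :
    ∃ e : List H, IsOrthonormalList e ∧ IsSVDStep φ e B.C B.D := by
  obtain ⟨S', t', ht', rfl⟩ := ht.exists_subtree_of_mem_level hB
  obtain ⟨e, he, -, hstep⟩ := ht'.exists_isSVDStep_root hχ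
  exact ⟨e, he, hstep⟩

end IsMultilevelTree

end MultilevelBasis

/-! ### Operators diagonalized by an orthonormal family -/

section Diagonalization

variable {𝕜 E F ι : Type*} [RCLike 𝕜] [NormedAddCommGroup E] [InnerProductSpace 𝕜 E]
  [CompleteSpace E] {φ : ι → E}

theorem summable_inner_smul_of_orthonormal (hφ : Orthonormal 𝕜 φ) (x : E) :
    Summable fun i => inner 𝕜 (φ i) x • φ i :=
  (hφ.orthogonalFamily.summable_iff_norm_sq_summable fun i => inner 𝕜 (φ i) x).2
    (hφ.inner_products_summable x)

theorem inner_tsum_inner_smul_of_orthonormal (hφ : Orthonormal 𝕜 φ) (x : E) (i : ι) :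
    inner 𝕜 (φ i) (∑' j, inner 𝕜 (φ j) x • φ j) = inner 𝕜 (φ i) x := by
  rw [← innerSL_apply_apply, (innerSL 𝕜 (φ i)).map_tsum (summable_inner_smul_of_orthonormal hφ x),
    tsum_eq_single i fun j hj => ?_]
  · simp [hφ.1 i]
  · rw [innerSL_apply_apply, inner_smul_right, hφ.2 hj.symm, mul_zero]

theorem hasSum_inner_smul_apply_of_orthonormal [NormedAddCommGroup F] [NormedSpace 𝕜 F]
    (T : E →L[𝕜] F) (hφ : Orthonormal 𝕜 φ) (hT : ∀ f, (∀ i, inner 𝕜 (φ i) f = 0) → T f = 0)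
    (x : E) : HasSum (fun i => inner 𝕜 (φ i) x • T (φ i)) (T x) := by
  have hx : T x = T (∑' i, inner 𝕜 (φ i) x • φ i) := by
    refine sub_eq_zero.1 (T.map_sub _ _ ▸ hT _ fun i => ?_)
    rw [inner_sub_right, inner_tsum_inner_smul_of_orthonormal hφ, sub_self]
  rw [hx]
  simpa only [map_smul] using T.hasSum (summable_inner_smul_of_orthonormal hφ x).hasSum

/-- The condition `hlam` says that `φ i` is an eigenvector of `T† T` with eigenvalue `lam i`. -/
theorem hasSum_norm_sq_apply_of_orthonormal [NormedAddCommGroup F] [InnerProductSpace 𝕜 F]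
    (T : E →L[𝕜] F) (hφ : Orthonormal 𝕜 φ) (hT : ∀ f, (∀ i, inner 𝕜 (φ i) f = 0) → T f = 0)
    {lam : ι → ℝ} (hlam : ∀ i f, inner 𝕜 (T f) (T (φ i)) = lam i * inner 𝕜 f (φ i)) (x : E) :
    HasSum (fun i => lam i * ‖inner 𝕜 (φ i) x‖ ^ 2) (‖T x‖ ^ 2) := by
  have hsum := (innerSL 𝕜 (T x)).hasSum (hasSum_inner_smul_apply_of_orthonormal T hφ hT x)
  have hterm : ∀ i, inner 𝕜 (T x) (inner 𝕜 (φ i) x • T (φ i)) =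
      ((lam i * ‖inner 𝕜 (φ i) x‖ ^ 2 : ℝ) : 𝕜) := fun i => by
    rw [inner_smul_right, hlam, mul_left_comm, ← inner_conj_symm x, RCLike.mul_conj]
    push_cast
    rfl
  simp only [innerSL_apply_apply, hterm, inner_self_eq_norm_sq_to_K] at hsum
  exact_mod_cast hsum

end Diagonalization

/-! ### Square integrable functions on a product space -/

section Product

variable {α β E 𝕜 : Type*} [MeasurableSpace α] [MeasurableSpace β] {μ : Measure α}
  {ν : Measure β} [NormedAddCommGroup E]

theorem inner_toLp_toLp_eq_integral [RCLike 𝕜] [InnerProductSpace 𝕜 E] {f g : α → E}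
    (hf : MemLp f 2 μ) (hg : MemLp g 2 μ) :
    inner 𝕜 (hf.toLp f) (hg.toLp g) = ∫ x, inner 𝕜 (f x) (g x) ∂μ := by
  rw [L2.inner_def]
  refine integral_congr_ae ?_
  filter_upwards [hf.coeFn_toLp, hg.coeFn_toLp] with x hfx hgx
  rw [hfx, hgx]

theorem norm_toLp_sq_eq_integral [InnerProductSpace ℝ E] {f : α → E} (hf : MemLp f 2 μ) :
    ‖hf.toLp f‖ ^ 2 = ∫ x, ‖f x‖ ^ 2 ∂μ := by
  rw [← real_inner_self_eq_norm_sq, inner_toLp_toLp_eq_integral hf hf]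
  simp only [real_inner_self_eq_norm_sq]

theorem ae_memLp_prodMk_left [SFinite ν] {w : α × β → E} {p : ENNReal}
    (hw : MemLp w p (μ.prod ν)) (hp₀ : p ≠ 0) (hp : p ≠ ⊤) :
    ∀ᵐ x ∂μ, MemLp (fun y => w (x, y)) p ν := by
  have hpow := hw.integrable_norm_rpow hp₀ hp
  filter_upwards [hw.1.prodMk_left, ((integrable_prod_iff hpow.1).1 hpow).1] with x hx hint
  exact (integrable_norm_rpow_iff hx hp₀ hp).1 hint

theorem ae_memLp_prodMk_right [SFinite μ] [SFinite ν] {w : α × β → E} {p : ENNReal}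
    (hw : MemLp w p (μ.prod ν)) (hp₀ : p ≠ 0) (hp : p ≠ ⊤) :
    ∀ᵐ y ∂ν, MemLp (fun x => w (x, y)) p μ := by
  filter_upwards [hw.1.prodMk_right, (hw.integrable_norm_rpow hp₀ hp).prod_left_ae] with y hy hint
  exact (integrable_norm_rpow_iff hy hp₀ hp).1 hint

theorem memLp_smul_prod [SFinite ν] [NormedField 𝕜] [NormedSpace 𝕜 E] {g : α → 𝕜} {h : β → E}
    {p : ENNReal} (hg : MemLp g p μ) (hh : MemLp h p ν) (hp₀ : p ≠ 0) (hp : p ≠ ⊤) :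
    MemLp (fun z : α × β => g z.1 • h z.2) p (μ.prod ν) := by
  have hmeas : AEStronglyMeasurable (fun z : α × β => g z.1 • h z.2) (μ.prod ν) :=
    hg.1.comp_fst.smul hh.1.comp_snd
  refine (integrable_norm_rpow_iff hmeas hp₀ hp).1 ?_
  simp only [norm_smul, Real.mul_rpow (norm_nonneg _) (norm_nonneg _)]
  exact (hg.integrable_norm_rpow hp₀ hp).mul_prod (hh.integrable_norm_rpow hp₀ hp)

theorem integrable_inner_smul_prod [SFinite ν] [RCLike 𝕜] [InnerProductSpace 𝕜 E] {F : Type*}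
    [NormedAddCommGroup F] [NormedSpace 𝕜 F] {w : α × β → E} {g : α → E} {h : β → F}
    (hw : MemLp w 2 (μ.prod ν)) (hg : MemLp g 2 μ) (hh : MemLp h 2 ν) :
    Integrable (fun z : α × β => inner 𝕜 (w z) (g z.1) • h z.2) (μ.prod ν) := by
  have hgh := memLp_smul_prod hg.norm hh.norm two_ne_zero ENNReal.ofNat_ne_top
  refine (hw.norm.integrable_mul hgh).mono ((hw.1.inner hg.1.comp_fst).smul hh.1.comp_snd) ?_
  refine .of_forall fun z => ?_
  calc ‖inner 𝕜 (w z) (g z.1) • h z.2‖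
      ≤ ‖w z‖ * ‖g z.1‖ * ‖h z.2‖ := by
        rw [norm_smul]
        gcongr
        exact norm_inner_le_norm _ _
    _ = ‖‖w z‖ * (‖g z.1‖ • ‖h z.2‖)‖ := by
        rw [smul_eq_mul, Real.norm_of_nonneg (by positivity), mul_assoc]

end Product

/-! ### Projection coefficients of a square integrable random field -/

section Field

variable {X Ω : Type*} [MeasurableSpace X] [MeasurableSpace Ω] {μ : Measure X} {P : Measure Ω}
  {q : ℕ} {v : X → Ω → EuclideanSpace ℝ (Fin q)}

omit [MeasurableSpace Ω] in
theorem projCoeff_eq_inner_toLp {ω : Ω} (hω : MemLp (fun x => v x ω) 2 μ) (f : L2Space μ q) :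
    projCoeff μ v f ω = inner ℝ (hω.toLp _) f := by
  conv_rhs => rw [← Lp.toLp_coeFn f (Lp.memLp f)]
  exact (inner_toLp_toLp_eq_integral hω (Lp.memLp f)).symm

theorem projCoeff_ae_congr [SFinite μ] [SFinite P] {u : X → Ω → EuclideanSpace ℝ (Fin q)}
    (h : ∀ᵐ z ∂(μ.prod P), u z.1 z.2 = v z.1 z.2) (f : L2Space μ q) :
    projCoeff μ u f =ᵐ[P] projCoeff μ v f := by
  have hswap : ∀ᵐ z ∂(P.prod μ), u z.2 z.1 = v z.2 z.1 :=
    Measure.measurePreserving_swap.quasiMeasurePreserving.ae h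
  filter_upwards [Measure.ae_ae_of_ae_prod hswap] with ω hω
  refine integral_congr_ae ?_
  filter_upwards [hω] with x hx
  rw [hx]

namespace IsL2Field

section Projection

variable [SFinite μ] [SFinite P] (hv : IsL2Field μ P v)

include hv

theorem ae_memLp_left : ∀ᵐ ω ∂P, MemLp (fun x => v x ω) 2 μ :=
  ae_memLp_prodMk_right hv two_ne_zero ENNReal.ofNat_ne_top

theorem integrable_integral_norm_sq : Integrable (fun ω => ∫ x, ‖v x ω‖ ^ 2 ∂μ) P :=
  ((memLp_two_iff_integrable_sq_norm hv.aestronglyMeasurable).1 hv).integral_prod_right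

theorem ae_projCoeff_sq_le (f : L2Space μ q) :
    ∀ᵐ ω ∂P, projCoeff μ v f ω ^ 2 ≤ (∫ x, ‖v x ω‖ ^ 2 ∂μ) * ‖f‖ ^ 2 := by
  filter_upwards [hv.ae_memLp_left] with ω hω
  rw [projCoeff_eq_inner_toLp hω, ← norm_toLp_sq_eq_integral hω, ← mul_pow, ← sq_abs]
  gcongr
  exact abs_real_inner_le_norm _ _

theorem memLp_projCoeff (f : L2Space μ q) : MemLp (projCoeff μ v f) 2 P := by
  have hinner : AEStronglyMeasurable (fun z : X × Ω => inner ℝ (v z.1 z.2) (f z.1)) (μ.prod P) :=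
    hv.aestronglyMeasurable.inner (Lp.aestronglyMeasurable f).comp_fst
  have hmeas : AEStronglyMeasurable (projCoeff μ v f) P := hinner.prod_swap.integral_prod_right'
  rw [memLp_two_iff_integrable_sq hmeas]
  refine (hv.integrable_integral_norm_sq.mul_const (‖f‖ ^ 2)).mono' (hmeas.pow 2) ?_
  filter_upwards [hv.ae_projCoeff_sq_le f] with ω hω
  rwa [Real.norm_of_nonneg (sq_nonneg _)]

theorem integral_projCoeff_sq_le (f : L2Space μ q) :
    ∫ ω, projCoeff μ v f ω ^ 2 ∂P ≤ (∫ ω, ∫ x, ‖v x ω‖ ^ 2 ∂μ ∂P) * ‖f‖ ^ 2 := by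
  rw [← integral_mul_const]
  exact integral_mono_ae (hv.memLp_projCoeff f).integrable_sq
    (hv.integrable_integral_norm_sq.mul_const _) (hv.ae_projCoeff_sq_le f)

theorem norm_toLp_projCoeff_le (f : L2Space μ q) :
    ‖(hv.memLp_projCoeff f).toLp _‖ ≤ √(∫ ω, ∫ x, ‖v x ω‖ ^ 2 ∂μ ∂P) * ‖f‖ := by
  have hnonneg : 0 ≤ ∫ ω, ∫ x, ‖v x ω‖ ^ 2 ∂μ ∂P :=
    integral_nonneg fun _ => integral_nonneg fun _ => sq_nonneg _
  refine le_of_sq_le_sq ?_ (by positivity)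
  rw [norm_toLp_sq_eq_integral, mul_pow, Real.sq_sqrt hnonneg]
  simpa only [Real.norm_eq_abs, sq_abs] using hv.integral_projCoeff_sq_le f

omit hv in
/-- The bounded operator `f ↦ ∫_U v(x, ·)ᵀ f(x) dx` from `L²(U; ℝ^q)` to `L²_P(Ω)`. Its Gram form
is the quadratic form of the covariance operator. -/
noncomputable def projOp (hv : IsL2Field μ P v) : L2Space μ q →L[ℝ] Lp ℝ 2 P :=
  LinearMap.mkContinuous
    { toFun := fun f => (hv.memLp_projCoeff f).toLp _
      map_add' := fun f g => by
        rw [← MemLp.toLp_add, MemLp.toLp_eq_toLp_iff]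
        filter_upwards [hv.ae_memLp_left] with ω hω
        simp only [Pi.add_apply, projCoeff_eq_inner_toLp hω, inner_add_right]
      map_smul' := fun c f => by
        rw [RingHom.id_apply, ← MemLp.toLp_const_smul, MemLp.toLp_eq_toLp_iff]
        filter_upwards [hv.ae_memLp_left] with ω hω
        simp only [Pi.smul_apply, projCoeff_eq_inner_toLp hω, inner_smul_right, smul_eq_mul] }
    √(∫ ω, ∫ x, ‖v x ω‖ ^ 2 ∂μ ∂P) hv.norm_toLp_projCoeff_le

theorem inner_projOp (f g : L2Space μ q) :
    inner ℝ (hv.projOp f) (hv.projOp g) = ∫ ω, projCoeff μ v f ω * projCoeff μ v g ω ∂P := by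
  refine (inner_toLp_toLp_eq_integral (hv.memLp_projCoeff f) (hv.memLp_projCoeff g)).trans ?_
  simp only [Real.inner_apply]

theorem norm_projOp_sq (f : L2Space μ q) :
    ‖hv.projOp f‖ ^ 2 = ∫ ω, projCoeff μ v f ω ^ 2 ∂P := by
  rw [← real_inner_self_eq_norm_sq, inner_projOp]
  simp only [sq]

end Projection

end IsL2Field

/-! ### The covariance operator -/

theorem covFn_apply_of_integral_eq_zero {X : Type*} {v : X → Ω → EuclideanSpace ℝ (Fin q)}
    {x y : X} (hx : Integrable (v x) P) (hy : Integrable (v y) P) (hx₀ : ∫ ω, v x ω ∂P = 0)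
    (hy₀ : ∫ ω, v y ω ∂P = 0) (i j : Fin q) :
    covFn P v x y i j = ∫ ω, v x ω i * v y ω j ∂P := by
  have hxi : ∫ ω, v x ω i ∂P = 0 := by rw [← eval_integral_piLp hx.eval_piLp, hx₀, PiLp.zero_apply]
  have hyj : ∫ ω, v y ω j ∂P = 0 := by rw [← eval_integral_piLp hy.eval_piLp, hy₀, PiLp.zero_apply]
  simp only [covFn, Matrix.of_apply, covariance, hxi, hyj, sub_zero]

theorem covFn_mulVec_eq_integral {X : Type*} {v : X → Ω → EuclideanSpace ℝ (Fin q)}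
    [IsFiniteMeasure P] {x y : X} (hx : MemLp (v x) 2 P) (hy : MemLp (v y) 2 P)
    (hx₀ : ∫ ω, v x ω ∂P = 0) (hy₀ : ∫ ω, v y ω ∂P = 0) (a : EuclideanSpace ℝ (Fin q)) :
    WithLp.toLp 2 ((covFn P v x y).mulVec a) = ∫ ω, inner ℝ (v y ω) a • v x ω ∂P := by
  have hint : Integrable (fun ω => inner ℝ (v y ω) a • v x ω) P :=
    (hx.smul (p := 2) (q := 2) (r := 1) (hy.inner_const (𝕜 := ℝ) a)).integrable le_rfl
  have hprod : ∀ i j, Integrable (fun ω => v x ω i * v y ω j) P := fun i j =>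
    (hx.eval_piLp i).integrable_mul (hy.eval_piLp j)
  ext i
  calc ∑ j, covFn P v x y i j * a j
      = ∑ j, ∫ ω, v x ω i * v y ω j * a j ∂P := by
        simp only [integral_mul_const, covFn_apply_of_integral_eq_zero (hx.integrable one_le_two)
          (hy.integrable one_le_two) hx₀ hy₀]
    _ = ∫ ω, ∑ j, v x ω i * v y ω j * a j ∂P :=
        (integral_finsetSum _ fun j _ => (hprod i j).mul_const _).symm
    _ = ∫ ω, (inner ℝ (v y ω) a • v x ω) i ∂P := by
        refine integral_congr_ae (.of_forall fun ω => ?_)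
        simp only [PiLp.smul_apply, PiLp.inner_apply, Real.inner_apply, smul_eq_mul,
          Finset.sum_mul]
        exact Finset.sum_congr rfl fun j _ => by ring
    _ = (∫ ω, inner ℝ (v y ω) a • v x ω ∂P) i := (eval_integral_piLp hint.eval_piLp i).symm

section Covariance

variable [SFinite μ] [IsFiniteMeasure P] (hmean : ∀ᵐ x ∂μ, ∫ ω, v x ω ∂P = 0)

include hmean

theorem IsL2Field.ae_covOp_eq (hv : IsL2Field μ P v) (g : L2Space μ q) :
    ∀ᵐ x ∂μ, covOp μ P v g x = ∫ ω, projCoeff μ v g ω • v x ω ∂P := by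
  have hmem := ae_memLp_prodMk_left hv two_ne_zero ENNReal.ofNat_ne_top
  filter_upwards [hmem, hmean] with x hx hx₀
  calc covOp μ P v g x
      = ∫ y, ∫ ω, inner ℝ (v y ω) (g y) • v x ω ∂P ∂μ := by
        refine integral_congr_ae ?_
        filter_upwards [hmem, hmean] with y hy hy₀
        exact covFn_mulVec_eq_integral hx hy hx₀ hy₀ (g y)
    _ = ∫ ω, ∫ y, inner ℝ (v y ω) (g y) • v x ω ∂μ ∂P :=
        integral_integral_swap (integrable_inner_smul_prod hv (Lp.memLp g) hx)
    _ = ∫ ω, projCoeff μ v g ω • v x ω ∂P := by simp only [integral_smul_const, projCoeff]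

theorem IsL2Field.inner_projOp_eq_integral_covOp (hv : IsL2Field μ P v) (f g : L2Space μ q) :
    inner ℝ (hv.projOp f) (hv.projOp g) = ∫ x, inner ℝ (f x) (covOp μ P v g x) ∂μ := by
  calc inner ℝ (hv.projOp f) (hv.projOp g)
      = ∫ ω, ∫ x, inner ℝ (v x ω) (f x) • projCoeff μ v g ω ∂μ ∂P := by
        simp only [hv.inner_projOp, integral_smul_const]
        rfl
    _ = ∫ x, ∫ ω, inner ℝ (v x ω) (f x) • projCoeff μ v g ω ∂P ∂μ :=
        (integral_integral_swap
          (integrable_inner_smul_prod hv (Lp.memLp f) (hv.memLp_projCoeff g))).symm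
    _ = ∫ x, inner ℝ (f x) (covOp μ P v g x) ∂μ := by
        refine integral_congr_ae ?_
        filter_upwards [hv.ae_covOp_eq hmean g,
          ae_memLp_prodMk_left hv two_ne_zero ENNReal.ofNat_ne_top] with x hcov hx
        have hint : Integrable (fun ω => projCoeff μ v g ω • v x ω) P :=
          (hx.smul (p := 2) (q := 2) (r := 1) (hv.memLp_projCoeff g)).integrable le_rfl
        rw [hcov, ← integral_inner hint]
        simp only [inner_smul_right, smul_eq_mul, real_inner_comm, mul_comm]

namespace IsKLSystem

variable {lam : ℕ → ℝ} {φ : ℕ → L2Space μ q}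

theorem hasSum_integral_projCoeff_sq (hKL : IsKLSystem μ P v lam φ) (hv : IsL2Field μ P v)
    (ψ : L2Space μ q) :
    HasSum (fun i => lam i * inner ℝ (φ i) ψ ^ 2) (∫ ω, projCoeff μ v ψ ω ^ 2 ∂P) := by
  have hker : ∀ f, (∀ i, inner ℝ (φ i) f = 0) → hv.projOp f = 0 := fun f hf => by
    rw [← inner_self_eq_zero (𝕜 := ℝ), hv.inner_projOp_eq_integral_covOp hmean]
    refine integral_eq_zero_of_ae ?_
    filter_upwards [hKL.exhaustive f hf] with x hx
    simp only [hx, Pi.zero_apply, inner_zero_right]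
  have hgram : ∀ i f, inner ℝ (hv.projOp f) (hv.projOp (φ i)) = lam i * inner ℝ f (φ i) :=
    fun i f => by
    rw [hv.inner_projOp_eq_integral_covOp hmean, L2.inner_def, ← integral_const_mul]
    refine integral_congr_ae ?_
    filter_upwards [hKL.eigen i] with x hx
    rw [hx, inner_smul_right]
  simpa only [Real.norm_eq_abs, sq_abs, hv.norm_projOp_sq] using
    hasSum_norm_sq_apply_of_orthonormal hv.projOp hKL.orthonormal hker hgram ψ

theorem integral_projCoeff_sq_le_tsum (hKL : IsKLSystem μ P v lam φ) (hv : IsL2Field μ P v)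
    {M : ℕ} (hlam : Summable fun i => lam (i + M)) {ψ : L2Space μ q}
    (hψ : ∀ i < M, inner ℝ (φ i) ψ = 0) :
    ∫ ω, projCoeff μ v ψ ω ^ 2 ∂P ≤ (∑' i, lam (i + M)) * ‖ψ‖ ^ 2 := by
  have hhead : ∑ i ∈ Finset.range M, lam i * inner ℝ (φ i) ψ ^ 2 = 0 :=
    Finset.sum_eq_zero fun i hi => by
      rw [hψ i (Finset.mem_range.1 hi), zero_pow two_ne_zero, mul_zero]
  have htail : HasSum (fun i => lam (i + M) * inner ℝ (φ (i + M)) ψ ^ 2)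
      (∫ ω, projCoeff μ v ψ ω ^ 2 ∂P) := by
    simpa only [hhead, sub_zero] using
      (hasSum_nat_add_iff' M).2 (hKL.hasSum_integral_projCoeff_sq hmean hv ψ)
  refine hasSum_le (fun i => ?_) htail (hlam.hasSum.mul_right _)
  refine mul_le_mul_of_nonneg_left ?_ (hKL.nonneg _)
  rw [← sq_abs]
  gcongr
  simpa only [hKL.orthonormal.1, one_mul] using abs_real_inner_le_norm (φ (i + M)) ψ

end IsKLSystem

end Covariance

theorem measureReal_le_of_integral_sq_le {f : Ω → ℝ} (hf : Integrable (fun ω => f ω ^ 2) P)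
    {s α : ℝ} (hs : 0 < s) (hfs : ∫ ω, f ω ^ 2 ∂P ≤ s) (hα : 0 < α) :
    P.real {ω | α ^ (-(1 / 2) : ℝ) * √s ≤ |f ω|} ≤ α := by
  have hpow : (α ^ (-(1 / 2) : ℝ)) ^ 2 = α⁻¹ := by
    rw [← Real.rpow_mul_natCast hα.le, ← Real.rpow_neg_one]
    norm_num
  have hset : {ω | α ^ (-(1 / 2) : ℝ) * √s ≤ |f ω|} = {ω | α⁻¹ * s ≤ f ω ^ 2} := by
    ext ω
    rw [Set.mem_ofPred_eq, Set.mem_ofPred_eq, ← sq_le_sq₀ (by positivity) (abs_nonneg _), mul_pow,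
      Real.sq_sqrt hs.le, hpow, sq_abs]
  have hcheb : α⁻¹ * s * P.real {ω | α⁻¹ * s ≤ f ω ^ 2} ≤ s :=
    (mul_meas_ge_le_integral_of_nonneg (.of_forall fun ω => sq_nonneg (f ω)) hf
      (α⁻¹ * s)).trans hfs
  rw [hset]
  rw [mul_assoc, inv_mul_le_iff₀ hα, mul_comm α s] at hcheb
  exact le_of_mul_le_mul_left hcheb hs

end Field

/-! ### Finiteness of the surface measure -/

section SurfaceMeasure

variable {V Q : Type*} [NormedAddCommGroup V] [InnerProductSpace ℝ V] [MetricSpace Q]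
  [NormedAddTorsor V Q] [MeasurableSpace Q] [BorelSpace Q]

theorem isFiniteMeasureOnCompacts_euclideanHausdorffMeasure_finrank [FiniteDimensional ℝ V] :
    IsFiniteMeasureOnCompacts (μHE[Module.finrank ℝ V] : Measure Q) := by
  borelize V
  let p : Q := Classical.arbitrary Q
  rw [EuclideanGeometry.euclideanHausdorffMeasure_eq p]
  exact Measure.IsFiniteMeasureOnCompacts.map volume (IsometryEquiv.vaddConst p).toHomeomorph

theorem euclideanHausdorffMeasure_finrank_direction_lt_top (s : AffineSubspace ℝ Q)
    [FiniteDimensional ℝ s.direction] {K : Set Q} (hK : IsCompact K) (hKs : K ⊆ s) :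
    μHE[Module.finrank ℝ s.direction] K < ⊤ := by
  rcases K.eq_empty_or_nonempty with rfl | ⟨p, hp⟩
  · simp only [measure_empty, ENNReal.zero_lt_top]
  have : Nonempty s := ⟨p, hKs hp⟩
  have := isFiniteMeasureOnCompacts_euclideanHausdorffMeasure_finrank (V := s.direction) (Q := s)
  have hcoe : ((↑) : s → Q) '' ((↑) ⁻¹' K) = K :=
    Set.image_preimage_eq_of_subset (hKs.trans_eq Subtype.range_coe.symm)
  rw [← hcoe, s.euclideanHausdorffMeasure_coe_image]
  exact (Subtype.isCompact_iff.2 (hcoe.symm ▸ hK)).measure_lt_top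

theorem euclideanHausdorffMeasure_convexHull_lt_top {E : Type*} [NormedAddCommGroup E]
    [InnerProductSpace ℝ E] [MeasurableSpace E] [BorelSpace E] {τ : Finset E}
    (hτ : AffineIndependent ℝ ((↑) : τ → E)) {k : ℕ} (hk : τ.card = k + 1) :
    μHE[k] (convexHull ℝ (τ : Set E)) < ⊤ := by
  have hdim : Module.finrank ℝ (affineSpan ℝ (τ : Set E)).direction = k := by
    rw [direction_affineSpan, ← Subtype.range_coe (s := (τ : Set E))]
    exact hτ.finrank_vectorSpan (by rw [Fintype.card_coe, hk])
  have : FiniteDimensional ℝ (affineSpan ℝ (τ : Set E)).direction := by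
    rw [direction_affineSpan]
    exact finiteDimensional_vectorSpan_of_finite ℝ τ.finite_toSet
  rw [← hdim]
  exact euclideanHausdorffMeasure_finrank_direction_lt_top _
    (τ.finite_toSet.isCompact_convexHull ℝ) (convexHull_subset_affineSpan _)

end SurfaceMeasure

theorem IsSimplicialMesh.isFiniteMeasure_meshMeasure {d k : ℕ}
    {T : Geometry.SimplicialComplex ℝ (EuclideanSpace ℝ (Fin d))}
    {𝒮 : Finset (Finset (EuclideanSpace ℝ (Fin d)))} (hmesh : IsSimplicialMesh T k 𝒮) :
    IsFiniteMeasure (meshMeasure k 𝒮) := by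
  refine isFiniteMeasure_restrict.2 (measure_biUnion_lt_top 𝒮.finite_toSet fun τ hτ => ?_).ne
  exact euclideanHausdorffMeasure_convexHull_lt_top (T.indep (hmesh.subset τ hτ))
    (hmesh.dim_eq τ hτ)

theorem mainTheorem2_general {X Ω ι : Type*} [MeasurableSpace X] [MeasurableSpace Ω]
    {μ : Measure X} [SFinite μ] {P : Measure Ω} [IsFiniteMeasure P] {d q r M n₀ : ℕ}
    {χ : ι → Fin r → L2Space μ q} (hχ : Orthonormal ℝ fun p : ι × Fin r => χ p.1 p.2)
    {v : X → Ω → EuclideanSpace ℝ (Fin q)} (hv : IsL2Field μ P v)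
    (hmean : ∀ᵐ x ∂μ, ∫ ω, v x ω ∂P = 0) {lam : ℕ → ℝ} {φ : ℕ → L2Space μ q}
    (hKL : IsKLSystem μ P v lam φ) (htail : 0 < ∑' i, lam (i + M))
    {x : ι → EuclideanSpace ℝ (Fin d)} {rule : SplitRule ι d} {S : Finset ι}
    {t : CellTree ι (L2Space μ q)}
    (ht : IsMultilevelTree x rule n₀ (fun i : Fin M => φ i) χ S t)
    {u : X → Ω → EuclideanSpace ℝ (Fin q)} (H₀ : ∀ᵐ z ∂(μ.prod P), u z.1 z.2 = v z.1 z.2)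
    {α : ℝ} (hα : 0 < α) {l : ℕ} {B : CellData ι (L2Space μ q)} (hB : B ∈ t.level l)
    {ψ : L2Space μ q} (hψ : ψ ∈ B.D) :
    P.real {ω | α ^ (-(1 / 2) : ℝ) * √(∑' i, lam (i + M)) ≤ |projCoeff μ u ψ ω|} ≤ α := by
  have hsummable : Summable fun i => lam (i + M) := by
    by_contra hdiv
    exact htail.ne' (tsum_eq_zero_of_not_summable hdiv)
  obtain ⟨e, he, hstep⟩ := ht.exists_isSVDStep hχ hB
  have hnorm : ‖ψ‖ = 1 := (hstep.isOrthonormalList he).2.2 ψ hψ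
  have hvar : ∫ ω, projCoeff μ v ψ ω ^ 2 ∂P ≤ ∑' i, lam (i + M) := by
    simpa only [hnorm, one_pow, mul_one] using hKL.integral_projCoeff_sq_le_tsum hmean hv hsummable
      fun i hi => hstep.inner_eq_zero ⟨i, hi⟩ hψ
  calc P.real {ω | α ^ (-(1 / 2) : ℝ) * √(∑' i, lam (i + M)) ≤ |projCoeff μ u ψ ω|}
      = P.real {ω | α ^ (-(1 / 2) : ℝ) * √(∑' i, lam (i + M)) ≤ |projCoeff μ v ψ ω|} := by
        refine measureReal_congr ?_
        filter_upwards [projCoeff_ae_congr H₀ ψ] with ω hω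
        exact congrArg (_ ≤ |·|) hω
    _ ≤ α :=
        measureReal_le_of_integral_sq_le (hv.memLp_projCoeff ψ).integrable_sq htail hvar hα

theorem mainTheorem2
    {Ω : Type*} [MeasurableSpace Ω] (P : Measure Ω) [IsProbabilityMeasure P]
    (d k q M n₀ : ℕ)
    (T : Geometry.SimplicialComplex ℝ (EuclideanSpace ℝ (Fin d)))
    (𝒮 : Finset (Finset (EuclideanSpace ℝ (Fin d))))
    (hmesh : IsSimplicialMesh T k 𝒮)
    (χ : 𝒮 → Fin q → L2Space (meshMeasure k 𝒮) q)
    (hχ : IsIndicatorBasis 𝒮 χ)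
    (v : EuclideanSpace ℝ (Fin d) → Ω → EuclideanSpace ℝ (Fin q))
    (hv : IsL2Field (meshMeasure k 𝒮) P v)
    (hmean : ∀ᵐ x ∂(meshMeasure k 𝒮), ∫ ω, v x ω ∂P = 0)
    (lam : ℕ → ℝ) (φ : ℕ → L2Space (meshMeasure k 𝒮) q)
    (hKL : IsKLSystem (meshMeasure k 𝒮) P v lam φ)
    (hM : M < 𝒮.card)
    (hφ : ∀ i < M, φ i ∈ Submodule.span ℝ (Set.range fun p : 𝒮 × Fin q => χ p.1 p.2))
    (htail : 0 < ∑' i, lam (i + M))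
    (rule : SplitRule 𝒮 d)
    (t : CellTree 𝒮 (L2Space (meshMeasure k 𝒮) q))
    (ht : IsMultilevelTree barycenter rule n₀ (fun i : Fin M => φ i) χ Finset.univ t)
    (u : EuclideanSpace ℝ (Fin d) → Ω → EuclideanSpace ℝ (Fin q))
    (H₀ : ∀ᵐ z ∂((meshMeasure k 𝒮).prod P), u z.1 z.2 = v z.1 z.2)
    (α : ℝ) (hα₀ : 0 < α) (hα₁ : α ≤ 1)
    (l : ℕ) (B : CellData 𝒮 (L2Space (meshMeasure k 𝒮) q)) (hB : B ∈ t.level l)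
    (ψ : L2Space (meshMeasure k 𝒮) q) (hψ : ψ ∈ B.D) :
    P.real {ω | α ^ (-(1 / 2) : ℝ) * √(∑' i, lam (i + M)) ≤
      |projCoeff (meshMeasure k 𝒮) u ψ ω|} ≤ α := by
  have := hmesh.isFiniteMeasure_meshMeasure
  exact mainTheorem2_general hχ.orthonormal hv hmean hKL htail ht H₀ hα₀ hB hψ
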